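/- Let $p$ be an odd prime, $m,s\ge 1$ integers, and $\mathcal R=\mathbb F_{p^m}[u,v]/\langle u^2,v^2,uv-vu\rangle$. Let $\alpha=\alpha_1+\alpha_2u+\alpha_3v+\alpha_4uv$ with $\alpha_1,\alpha_2,\alpha_3\in\mathbb F_{p^m}^{*}$, $\alpha_4\in\mathbb F_{p^m}$, and assume that $\alpha$ is not a square in $\mathcal R$. Let $\alpha_0=\alpha_1^{p^{m-r_0}}$, where $r_0$ is the remainder of $s$ modulo $m$ (so $\alpha_0^{p^s}=\alpha_1$). Identify a word $(c_0,\dots,c_{2p^s-1})\in\mathcal R^{2p^s}$ with the class of $c_0+c_1x+\cdots+c_{2p^s-1}x^{2p^s-1}$ in $\mathcal R_\alpha=\mathcal R[x]/\langle x^{2p^s}-\alpha\rangle$, so that ideals of $\mathcal R_\alpha$ are codes of length $2p^s$ over $\mathcal R$. For a code $\mathcal C$ of length $n$ let $d_{sp}(\mathcal C)$ be the minimum, over distinct $x,y\in\mathcal C$, of $|\{i\in\mathbb Z/n : (x_i,x_{i+1})\ne(y_i,y_{i+1})\}|$. Let $$\mathcal C=\langle (x^2-\alpha_0)^\ell+u(x^2-\alpha_0)^t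 z(x)\rangle\subseteq\mathcal R_\alpha,\qquad 0\le\ell\le 2p^s-1,\quad 0\le t<\ell,$$ where $z(x)\in\mathcal R_\alpha$ is $0$ or a unit, and let $\Im$ be the smallest integer $k\ge 0$ with $u(x^2-\alpha_0)^k\in\mathcal C$. Then $d_{sp}(\mathcal C)=d_{sp}(\langle u(x^2-\alpha_0)^{\Im}\rangle)$, and $$d_{sp}(\mathcal C)=\begin{cases}2 & \text{if } 0\le\Im\le p^s,\\ 2(\Gamma+1)p^\gamma & \text{if } 2p^s-p^{s-\gamma}+(\Gamma-1)p^{s-\gamma-1}+1\le\Im\le 2p^s-p^{s-\gamma}+\Gamma p^{s-\gamma-1},\end{cases}$$ where in the second case $\Gamma,\gamma$ are any integers with $1\le\Gamma\le p-1$ and $0\le\gamma\le s-1$. -/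

import Mathlib

noncomputable section

namespace Constacyclic

open Polynomial

/-- The ring `F[u, v] / ⟨u², v², uv - vu⟩`. -/
abbrev BaseRing (F : Type*) [Field F] : Type _ :=
  MvPolynomial (Fin 2) F ⧸
    (Ideal.span {MvPolynomial.X 0 ^ 2, MvPolynomial.X 1 ^ 2,
      MvPolynomial.X 0 * MvPolynomial.X 1 - MvPolynomial.X 1 * MvPolynomial.X 0} :
      Ideal (MvPolynomial (Fin 2) F))

/-- The class of the first variable in `F[u, v] / ⟨u², v², uv - vu⟩`. -/
def u (F : Type*) [Field F] : BaseRing F :=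
  Ideal.Quotient.mk _ (MvPolynomial.X 0)

/-- The class of the second variable in `F[u, v] / ⟨u², v², uv - vu⟩`. -/
def v (F : Type*) [Field F] : BaseRing F :=
  Ideal.Quotient.mk _ (MvPolynomial.X 1)

/-- The element `a₁ + a₂ u + a₃ v + a₄ uv`. -/
def elt {F : Type*} [Field F] (a₁ a₂ a₃ a₄ : F) : BaseRing F :=
  algebraMap F (BaseRing F) a₁ + algebraMap F (BaseRing F) a₂ * u F
    + algebraMap F (BaseRing F) a₃ * v F + algebraMap F (BaseRing F) a₄ * (u F * v F)

/-- The ambient ring `A[x] / ⟨xⁿ - α⟩` of `α`-constacyclic codes of length `n` over `A`. -/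
abbrev Ambient {A : Type*} [CommRing A] (n : ℕ) (α : A) : Type _ :=
  AdjoinRoot (X ^ n - C α : A[X])

/-- The class of the polynomial `c₀ + c₁ x + ⋯ + cₙ₋₁ xⁿ⁻¹` of a word `c` of length `n`. -/
def wordClass {A : Type*} [CommRing A] (n : ℕ) (α : A) (c : Fin n → A) : Ambient n α :=
  AdjoinRoot.mk (X ^ n - C α : A[X]) (∑ i : Fin n, C (c i) * X ^ (i : ℕ))

/-- The code attached to an ideal of `A[x] / ⟨xⁿ - α⟩`: all words of length `n` whose polynomial
represents an element of the ideal. -/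
def code {A : Type*} [CommRing A] {n : ℕ} {α : A} (I : Ideal (Ambient n α)) :
    Set (Fin n → A) :=
  {c | wordClass n α c ∈ I}

open Classical in
/-- The symbol-pair distance of two words: the number of positions `i` (read cyclically, so that
`finRotate n i` is the position following `i`) with `(xᵢ, xᵢ₊₁) ≠ (yᵢ, yᵢ₊₁)`. -/
def pairDist {A : Type*} {n : ℕ} (x y : Fin n → A) : ℕ :=
  (Finset.univ.filter fun i : Fin n =>
    (x i, x (finRotate n i)) ≠ (y i, y (finRotate n i))).card

/-- The symbol-pair distance of a code: the minimum of the symbol-pair distances of its pairs of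
distinct words (and `0` for a code without such a pair). -/
def codePairDist {A : Type*} {n : ℕ} (S : Set (Fin n → A)) : ℕ :=
  sInf {d : ℕ | ∃ x ∈ S, ∃ y ∈ S, x ≠ y ∧ pairDist x y = d}

/-- `α₀ = α₁ ^ (p ^ (m - r₀))`, where `r₀` is the remainder of `s` modulo `m`; in a field with
`p ^ m` elements, this is the element with `α₀ ^ (p ^ s) = α₁`. -/
def alphaZero {F : Type*} [Field F] (p m s : ℕ) (α₁ : F) : F :=
  α₁ ^ p ^ (m - s % m)

/-- The class of `x² - α₀` in `A[x] / ⟨xⁿ - α⟩`, where `A = F[u, v] / ⟨u², v², uv - vu⟩`. -/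
def quad {F : Type*} [Field F] (n : ℕ) (α : BaseRing F) (α₀ : F) : Ambient n α :=
  AdjoinRoot.mk (X ^ n - C α : (BaseRing F)[X]) (X ^ 2 - C (algebraMap F (BaseRing F) α₀))

/-- The class of the constant `u` in `A[x] / ⟨xⁿ - α⟩`, where
`A = F[u, v] / ⟨u², v², uv - vu⟩`. -/
def uClass {F : Type*} [Field F] (n : ℕ) (α : BaseRing F) : Ambient n α :=
  AdjoinRoot.of (X ^ n - C α : (BaseRing F)[X]) (u F)

/-- The ideal `⟨u (x² - α₀) ^ k⟩`. -/
def idealB {F : Type*} [Field F] (n : ℕ) (α : BaseRing F) (α₀ : F) (k : ℕ) :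
    Ideal (Ambient n α) :=
  Ideal.span {uClass n α * quad n α α₀ ^ k}

/-- The ideal `⟨(x² - α₀) ^ l + u (x² - α₀) ^ t z⟩`. -/
def idealC {F : Type*} [Field F] (n : ℕ) (α : BaseRing F) (α₀ : F) (l t : ℕ)
    (z : Ambient n α) : Ideal (Ambient n α) :=
  Ideal.span {quad n α α₀ ^ l + uClass n α * quad n α α₀ ^ t * z}

end Constacyclic

end

/-! Write f = x² - α₀ and N = p^s. The Frobenius and x^(2N) = α give f^N = α₂u + α₃v + α₄uv. Since α
is not a square, neither is α₀, so f is irreducible over F; since α₃ ≠ 0, v lies in ⟨f, u⟩. Hence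
the ambient ring is local with maximal ideal ⟨f, u⟩, and as u² = 0 every multiple of u is 0 or u f^j
times a unit (`isUnit_or_exists_eq`, `uClass_mul_mem_idealB`). So the multiples of u in 𝒞 form ⟨u
f^ℑ⟩. Multiplying a word by u never increases its pair weight, and a word killed by u is already a
multiple of u; this gives the equality of distances (`codePairDist_eq_idealB`).

Next, u f^N = α₃uv, and uv is killed by u, v and f^N. So ⟨u f^(N+j)⟩ consists of the words uv·Q with
Q over F of degree < 2N and f^j ∣ Q. The even and odd halves of Q are both divisible by (X - α₀)^j.
Two positions of the same parity are never adjacent, so a half with w nonzero coefficients meets 2w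
pairs. The pair distance is therefore twice the Hamming distance of the repeated-root code ⟨(X -
α₀)^j⟩ of length p^s, which is bounded below by `mul_pow_le_card_support` and attained by a power of
X - α₀ (`card_support_X_sub_C_pow_le`). -/

noncomputable section

namespace Constacyclic

open Polynomial

/-! ### Hamming weights of multiples of (X - a)^i in characteristic p -/

section Weight

variable {F : Type*} [Field F]

/-- The linear operator `x ^ e ↦ (e / q) x ^ e`. -/
def digitOp (q : ℕ) (A : F[X]) : F[X] :=
  A.sum fun e a => monomial e (((e / q : ℕ) : F) * a)

theorem coeff_digitOp (q : ℕ) (A : F[X]) (e : ℕ) :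
    (digitOp q A).coeff e = ((e / q : ℕ) : F) * A.coeff e := by
  classical
  simp only [digitOp, Polynomial.sum, finsetSum_coeff, coeff_monomial]
  rw [Finset.sum_ite_eq']
  split_ifs with h
  · rfl
  · rw [notMem_support_iff.1 h, mul_zero]

/-- A Leibniz rule: a shift by q raises the block number e / q by one, so `digitOp q` acts like a
derivation sending X^q to itself. As with a derivative, it lowers the order of vanishing along X^q -
b by at most one. -/
theorem digitOp_X_pow_sub_C_mul {q : ℕ} (hq : 0 < q) (b : F) (D : F[X]) :
    digitOp q ((X ^ q - C b) * D) = (X ^ q - C b) * digitOp q D + X ^ q * D := by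
  ext e
  simp only [coeff_digitOp, sub_mul, coeff_add, coeff_sub, coeff_C_mul, coeff_X_pow_mul']
  split_ifs with h
  · have : e / q = (e - q) / q + 1 := by
      conv_lhs => rw [← Nat.sub_add_cancel h]
      exact Nat.add_div_right _ hq
    rw [this]; push_cast; ring
  · ring

theorem digitOp_X_pow_sub_C_pow_mul {q : ℕ} (hq : 0 < q) (b : F) (k : ℕ) (D : F[X]) :
    digitOp q ((X ^ q - C b) ^ (k + 1) * D) =
      (X ^ q - C b) ^ k * ((X ^ q - C b) * digitOp q D + (k + 1 : F[X]) * X ^ q * D) := by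
  induction k with
  | zero => simp [digitOp_X_pow_sub_C_mul hq]
  | succ k ih =>
    rw [pow_succ' _ (k + 1), mul_assoc, digitOp_X_pow_sub_C_mul hq, ih]
    push_cast; ring

theorem X_sub_C_pow_char_pow (p r : ℕ) [Fact p.Prime] [CharP F p] (a : F) :
    (X - C a) ^ p ^ r = X ^ p ^ r - C (a ^ p ^ r) := by
  rw [sub_pow_char_pow, C_pow]

/-- If all exponents lay in one block, A would be X^(dq) D with deg D < q; but X^q - b is coprime to
X, so it would divide D. -/
theorem exists_support_div_ne {q : ℕ} (hq : 0 < q) {b : F} (hb : b ≠ 0) {A : F[X]} (hA : A ≠ 0)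
    (hdvd : X ^ q - C b ∣ A) (d : ℕ) : ∃ e ∈ A.support, e / q ≠ d := by
  by_contra! h
  have hXA : X ^ (d * q) ∣ A := by
    rw [X_pow_dvd_iff]
    intro e he
    by_contra hne
    have h1 := h e (mem_support_iff.2 hne)
    have := (Nat.div_lt_iff_lt_mul hq).2 he
    omega
  obtain ⟨D, rfl⟩ := hXA
  have hD : D ≠ 0 := by rintro rfl; simp at hA
  have hcop : IsCoprime (X ^ q - C b) (X ^ (d * q) : F[X]) := by
    apply IsCoprime.pow_right
    refine IsCoprime.of_isCoprime_of_dvd_right (y := X ^ q) ⟨-C b⁻¹, C b⁻¹, ?_⟩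
      (dvd_pow_self _ hq.ne')
    have : C b⁻¹ * C b = (1 : F[X]) := by rw [← C_mul, inv_mul_cancel₀ hb, C_1]
    linear_combination this
  have h1 := natDegree_le_of_dvd (hcop.dvd_of_dvd_mul_left hdvd) hD
  rw [natDegree_X_pow_sub_C] at h1
  have h2 := h (d * q + D.natDegree) (by
    rw [mem_support_iff, add_comm, coeff_X_pow_mul]
    simpa using hD)
  rw [add_comm, Nat.add_mul_div_right _ _ hq] at h2
  have := Nat.div_pos h1 hq
  omega

/-- Induction on k: a combination of A and `digitOp q A` kills at least one term of A, at the cost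
of only q = p^r in the order of vanishing at a. -/
theorem add_two_le_card_support (p r : ℕ) [Fact p.Prime] [CharP F p] {a : F} (ha : a ≠ 0)
    (k : ℕ) : ∀ A : F[X], A ≠ 0 → A.natDegree < p * p ^ r →
      (X - C a) ^ (k * p ^ r + 1) ∣ A → k + 2 ≤ A.support.card := by
  have hq : 0 < p ^ r := pow_pos (Fact.out : p.Prime).pos r
  induction k with
  | zero =>
    intro A hA _ hdvd
    by_contra! hlt
    have h1 : A.support.card ≤ 1 := by omega
    obtain ⟨n, c, rfl⟩ := card_support_le_one_iff_monomial.1 h1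
    have : X - C a ∣ monomial n c := by simpa using hdvd
    rw [dvd_iff_isRoot, IsRoot, eval_monomial] at this
    rcases mul_eq_zero.1 this with h | h
    · exact hA (by rw [h, monomial_zero_right])
    · exact pow_ne_zero _ ha h
  | succ k ih =>
    intro A hA hdeg hdvd
    set q := p ^ r with hqdef
    have hfrob : (X - C a) ^ q = X ^ q - C (a ^ q) := X_sub_C_pow_char_pow p r a
    obtain ⟨e, he⟩ := nonempty_support_iff.2 hA
    obtain ⟨e', he', hne⟩ := exists_support_div_ne hq (pow_ne_zero q ha) hA
      (by rw [← hfrob]; exact (pow_dvd_pow _ (by nlinarith)).trans hdvd) (e / q)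
    set B := digitOp q A - C ((e / q : ℕ) : F) * A with hB
    have hcoeff : ∀ i, B.coeff i = (((i / q : ℕ) : F) - ((e / q : ℕ) : F)) * A.coeff i := by
      intro i; rw [hB, coeff_sub, coeff_digitOp, coeff_C_mul]; ring
    have hlt : ∀ i ∈ A.support, i / q < p := fun i hi =>
      (Nat.div_lt_iff_lt_mul hq).2 ((le_natDegree_of_mem_supp i hi).trans_lt hdeg)
    -- The degree bound keeps block numbers below p, so distinct ones stay distinct in F and the
    -- term at e' survives.
    have hB0 : B ≠ 0 := by
      intro h0
      have h1 := hcoeff e'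
      rw [h0, coeff_zero, eq_comm, mul_eq_zero, or_iff_left (mem_support_iff.1 he'), sub_eq_zero,
        CharP.natCast_eq_natCast F p] at h1
      exact hne (Nat.ModEq.eq_of_lt_of_lt h1 (hlt _ he') (hlt _ he))
    have hsub : B.support ⊆ A.support.erase e := by
      intro i hi
      rw [mem_support_iff, hcoeff] at hi
      rw [Finset.mem_erase, mem_support_iff]
      exact ⟨by rintro rfl; simp at hi, right_ne_zero_of_mul hi⟩
    have hBdvd : (X - C a) ^ (k * q + 1) ∣ B := by
      refine dvd_sub ?_ ((pow_dvd_pow _ (by nlinarith)).trans hdvd |>.mul_left _)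
      obtain ⟨D, rfl⟩ := hdvd
      have : (X - C a) ^ ((k + 1) * q + 1) * D =
          (X ^ q - C (a ^ q)) ^ (k + 1) * ((X - C a) * D) := by
        rw [← hfrob, ← pow_mul]; ring
      rw [this, digitOp_X_pow_sub_C_pow_mul hq, ← hfrob, ← pow_mul, pow_succ, mul_comm k q]
      refine mul_dvd_mul_left _ (dvd_add ?_ ?_)
      · exact (dvd_pow_self _ hq.ne').mul_right _
      · exact (Dvd.intro _ rfl).mul_left _
    have hcard := Finset.card_le_card hsub
    rw [Finset.card_erase_of_mem he] at hcard
    have := ih B hB0 (lt_of_le_of_lt ?_ hdeg) hBdvd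
    · omega
    · exact natDegree_le_iff_coeff_eq_zero.2 fun i hi => by
        rw [hcoeff, coeff_eq_zero_of_natDegree_lt hi, mul_zero]

/-- Since deg D < q, exponents kq + i determine k and i, so no two products of terms collide. -/
theorem card_support_expand_mul {q : ℕ} {G D : F[X]} (hD : D.natDegree < q) :
    G.support.card * D.support.card ≤ (expand F q G * D).support.card := by
  rw [← Finset.card_product]
  have hq : 0 < q := by omega
  have hcoeff : ∀ k i, i < q → (expand F q G * D).coeff (k * q + i) = G.coeff k * D.coeff i := by
    intro k i hi
    rw [coeff_mul, Finset.sum_eq_single (k * q, i)]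
    · rw [coeff_expand_mul hq]
    · rintro ⟨x, y⟩ hxy hne
      rw [Finset.HasAntidiagonal.mem_antidiagonal] at hxy
      by_contra h0
      have hx := left_ne_zero_of_mul h0
      have hy := right_ne_zero_of_mul h0
      rw [coeff_expand hq] at hx
      have hyq : y < q := lt_of_le_of_lt (le_natDegree_of_ne_zero hy) hD
      simp only [ne_eq, ite_eq_right_iff, Classical.not_imp] at hx
      obtain ⟨⟨c, rfl⟩, -⟩ := hx
      simp only at hxy
      have h1 : (q * c + y) / q = (k * q + i) / q := by rw [hxy]
      rw [Nat.mul_add_div hq, mul_comm k q, Nat.mul_add_div hq, Nat.div_eq_of_lt hyq,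
        Nat.div_eq_of_lt hi] at h1
      apply hne
      have hck : c = k := by omega
      subst hck
      rw [mul_comm c q] at *
      simp only [Prod.mk.injEq, true_and]
      omega
    · intro h; simp at h
  refine Finset.card_le_card_of_injOn (fun x => x.1 * q + x.2) ?_ ?_
  · rintro ⟨k, i⟩ h
    simp only [Finset.coe_product, Set.mem_prod, Finset.mem_coe, mem_support_iff] at h ⊢
    rw [hcoeff k i (lt_of_le_of_lt (le_natDegree_of_ne_zero h.2) hD)]
    exact mul_ne_zero h.1 h.2
  · rintro ⟨k, i⟩ h ⟨k', i'⟩ h' heq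
    simp only [Finset.coe_product, Set.mem_prod, Finset.mem_coe, mem_support_iff] at h h' heq
    have hi := lt_of_le_of_lt (le_natDegree_of_ne_zero h.2) hD
    have hi' := lt_of_le_of_lt (le_natDegree_of_ne_zero h'.2) hD
    have h1 : (k * q + i) / q = (k' * q + i') / q := by rw [heq]
    rw [mul_comm k, mul_comm k', Nat.mul_add_div hq, Nat.mul_add_div hq, Nat.div_eq_of_lt hi,
      Nat.div_eq_of_lt hi'] at h1
    have : k = k' := by omega
    subst this
    simp only [Prod.mk.injEq, true_and]
    omega

theorem le_card_support_X_sub_C_pow (p : ℕ) [Fact p.Prime] [CharP F p] {b : F} (hb : b ≠ 0) :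
    p ≤ ((X - C b) ^ (p - 1) : F[X]).support.card := by
  have hp : p.Prime := Fact.out
  conv_lhs => rw [← Finset.card_range p]
  refine Finset.card_le_card fun i hi => ?_
  rw [Finset.mem_range] at hi
  rw [mem_support_iff, sub_eq_add_neg, ← C_neg, coeff_X_add_C_pow]
  refine mul_ne_zero (pow_ne_zero _ (neg_ne_zero.2 hb)) ?_
  rw [Ne, CharP.cast_eq_zero_iff F p]
  intro h
  have : p ∣ (p - 1).factorial := by
    rw [← Nat.choose_mul_factorial_mul_factorial (show i ≤ p - 1 by omega), mul_assoc]
    exact h.mul_right _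
  have := (hp.dvd_factorial).1 this
  have := hp.pos
  omega

/-- Each increase of γ adds a factor (X - a)^(q(p-1)) = (X^q - a^q)^(p-1). It has p nonzero terms,
and the cofactor has degree < q, so the weight is multiplied by at least p. -/
theorem mul_pow_le_card_support (p r k : ℕ) [Fact p.Prime] [CharP F p] {a : F} (ha : a ≠ 0)
    (γ : ℕ) : ∀ A : F[X], A ≠ 0 → A.natDegree < p ^ (r + 1 + γ) →
      (X - C a) ^ (p ^ (r + 1) * (p ^ γ - 1) + k * p ^ r + 1) ∣ A →
      (k + 2) * p ^ γ ≤ A.support.card := by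
  have hp : p.Prime := Fact.out
  induction γ with
  | zero =>
    intro A hA hdeg hdvd
    simpa using add_two_le_card_support p r ha k A hA
      (by rwa [add_zero, pow_succ'] at hdeg) (by simpa using hdvd)
  | succ γ ih =>
    intro A hA hdeg hdvd
    set q := p ^ (r + 1 + γ) with hq
    have hq0 : 0 < q := pow_pos hp.pos _
    have hpow : p ^ (r + 1) * (p ^ (γ + 1) - 1) + k * p ^ r + 1 =
        q * (p - 1) + (p ^ (r + 1) * (p ^ γ - 1) + k * p ^ r + 1) := by
      have h1 : 1 ≤ p ^ γ := Nat.one_le_pow _ _ hp.pos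
      have h2 : 1 ≤ p ^ (γ + 1) := Nat.one_le_pow _ _ hp.pos
      have h3 : 1 ≤ p := hp.pos
      rw [hq]
      zify [h1, h2, h3]
      ring
    have hfrob : (X - C a) ^ (q * (p - 1)) = expand F q ((X - C (a ^ q)) ^ (p - 1)) := by
      rw [pow_mul, hq, X_sub_C_pow_char_pow]
      simp
    rw [hpow, pow_add] at hdvd
    obtain ⟨D, rfl⟩ := hdvd
    rw [mul_assoc] at *
    set E := (X - C a) ^ (p ^ (r + 1) * (p ^ γ - 1) + k * p ^ r + 1) * D with hE
    have hE0 : E ≠ 0 := right_ne_zero_of_mul hA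
    have hEdeg : E.natDegree < q := by
      rw [natDegree_mul (left_ne_zero_of_mul hA) hE0, natDegree_pow, natDegree_X_sub_C, mul_one,
        ← add_assoc, pow_succ, ← hq] at hdeg
      have : q * p = q * (p - 1) + q := by
        conv_lhs => rw [← Nat.sub_add_cancel hp.one_le]
        ring
      omega
    have h1 := ih E hE0 hEdeg (Dvd.intro _ rfl)
    rw [hfrob]
    calc (k + 2) * p ^ (γ + 1) = p * ((k + 2) * p ^ γ) := by ring
      _ ≤ _ := Nat.mul_le_mul (le_card_support_X_sub_C_pow p (pow_ne_zero q ha)) h1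
      _ ≤ _ := card_support_expand_mul hEdeg

theorem card_support_expand_le {q : ℕ} (hq : 0 < q) (A : F[X]) :
    (expand F q A).support.card ≤ A.support.card := by
  have hsub : (expand F q A).support ⊆ A.support.image (· * q) := by
    intro i hi
    rw [mem_support_iff, coeff_expand hq] at hi
    simp only [ne_eq, ite_eq_right_iff, Classical.not_imp] at hi
    exact Finset.mem_image.2 ⟨i / q, mem_support_iff.2 hi.2, Nat.div_mul_cancel hi.1⟩
  exact (Finset.card_le_card hsub).trans Finset.card_image_le

/-- By the Frobenius the power is (X^(p^(r+1)) - b)^(p^γ-1) · (X^(p^r) - b')^k, with at most p^γ and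
k + 1 terms in the two factors. -/
theorem card_support_X_sub_C_pow_le (p r k γ : ℕ) [Fact p.Prime] [CharP F p] (a : F) :
    ((X - C a) ^ (p ^ (r + 1) * (p ^ γ - 1) + k * p ^ r) : F[X]).support.card ≤
      (k + 1) * p ^ γ := by
  have hp : p.Prime := Fact.out
  rw [pow_add, mul_comm k, pow_mul, pow_mul, X_sub_C_pow_char_pow, X_sub_C_pow_char_pow]
  have key : ∀ i j (b : F), ((X ^ p ^ i - C b) ^ j : F[X]).support.card ≤ j + 1 := by
    intro i j b
    have := (card_support_expand_le (pow_pos hp.pos i) ((X - C b) ^ j)).trans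
      (card_supp_le_succ_natDegree _)
    simpa using this
  refine card_support_mul_le.trans ?_
  rw [mul_comm]
  refine Nat.mul_le_mul (key _ _ _) ((key _ _ _).trans ?_)
  have : 1 ≤ p ^ γ := Nat.one_le_pow _ _ hp.pos
  omega

end Weight

/-! ### The base ring: coordinates in 1, u, v, uv -/

section BaseRing

variable {F : Type*} [Field F]

theorem u_mul_u : u F * u F = 0 := by
  rw [u, ← map_mul, ← pow_two]
  exact Ideal.Quotient.eq_zero_iff_mem.2 (Ideal.subset_span (by simp))

theorem v_mul_v : v F * v F = 0 := by
  rw [v, ← map_mul, ← pow_two]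
  exact Ideal.Quotient.eq_zero_iff_mem.2 (Ideal.subset_span (by simp))

/-- The evaluation `u ↦ ε`, `v ↦ η` in the dual numbers over the dual numbers. -/
def evalDual (F : Type*) [Field F] : MvPolynomial (Fin 2) F →+* DualNumber (DualNumber F) :=
  MvPolynomial.eval₂Hom (R := F) (S₁ := DualNumber (DualNumber F))
    ((TrivSqZeroExt.inlHom (DualNumber F) (DualNumber F)).comp (TrivSqZeroExt.inlHom F F))
    ![TrivSqZeroExt.inl (TrivSqZeroExt.inr 1), TrivSqZeroExt.inr 1]

theorem evalDual_C (a : F) :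
    evalDual F (MvPolynomial.C a) = TrivSqZeroExt.inl (TrivSqZeroExt.inl a) :=
  MvPolynomial.eval₂Hom_C (R := F) (S₁ := DualNumber (DualNumber F)) _ _ _

theorem evalDual_X_zero :
    evalDual F (MvPolynomial.X 0) = TrivSqZeroExt.inl (TrivSqZeroExt.inr 1) :=
  MvPolynomial.eval₂Hom_X' (R := F) (S₁ := DualNumber (DualNumber F)) _ _ _

theorem evalDual_X_one : evalDual F (MvPolynomial.X 1) = TrivSqZeroExt.inr 1 :=
  MvPolynomial.eval₂Hom_X' (R := F) (S₁ := DualNumber (DualNumber F)) _ _ _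

/-- The map `a₁ + a₂ u + a₃ v + a₄ uv ↦ (a₁ + a₂ ε) + (a₃ + a₄ ε) η` to the dual numbers over
the dual numbers. -/
def toDual (F : Type*) [Field F] : BaseRing F →+* DualNumber (DualNumber F) :=
  Ideal.Quotient.lift _ (evalDual F) (by
    intro a ha
    rw [← RingHom.mem_ker]
    refine (Ideal.span_le.2 ?_) ha
    rintro x (rfl | rfl | rfl) <;> rw [SetLike.mem_coe, RingHom.mem_ker]
    · rw [map_pow, evalDual_X_zero, pow_two, ← TrivSqZeroExt.inl_mul, TrivSqZeroExt.inr_mul_inr,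
        TrivSqZeroExt.inl_zero]
    · rw [map_pow, evalDual_X_one, pow_two, TrivSqZeroExt.inr_mul_inr]
    · rw [mul_comm, sub_self, map_zero])

theorem toDual_elt (a b c d : F) : toDual F (elt a b c d) =
    TrivSqZeroExt.inl (TrivSqZeroExt.inl a + TrivSqZeroExt.inr b) +
      TrivSqZeroExt.inr (TrivSqZeroExt.inl c + TrivSqZeroExt.inr d) := by
  have hF : ∀ a : F, toDual F (algebraMap F (BaseRing F) a) =
      TrivSqZeroExt.inl (TrivSqZeroExt.inl a) := by
    exact fun a => evalDual_C a
  have hu : toDual F (u F) = TrivSqZeroExt.inl (TrivSqZeroExt.inr 1) := by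
    exact evalDual_X_zero
  have hv : toDual F (v F) = TrivSqZeroExt.inr 1 := by
    exact evalDual_X_one
  simp only [elt, map_add, map_mul, hF, hu, hv]
  ext <;> simp

/-- Independence of 1, u, v, uv is read off in the iterated dual numbers, where the four coordinates
are visible. -/
theorem elt_eq_zero {a b c d : F} (h : elt a b c d = 0) : a = 0 ∧ b = 0 ∧ c = 0 ∧ d = 0 := by
  have h1 := toDual_elt a b c d
  rw [h, map_zero] at h1
  have h2 := congrArg TrivSqZeroExt.fst h1
  have h3 := congrArg TrivSqZeroExt.snd h1
  simp only [TrivSqZeroExt.fst_add, TrivSqZeroExt.snd_add, TrivSqZeroExt.fst_zero,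
    TrivSqZeroExt.snd_zero, TrivSqZeroExt.fst_inl, TrivSqZeroExt.fst_inr,
    TrivSqZeroExt.snd_inl, TrivSqZeroExt.snd_inr, add_zero, zero_add] at h2 h3
  refine ⟨?_, ?_, ?_, ?_⟩
  · simpa using (congrArg TrivSqZeroExt.fst h2).symm
  · simpa using (congrArg TrivSqZeroExt.snd h2).symm
  · simpa using (congrArg TrivSqZeroExt.fst h3).symm
  · simpa using (congrArg TrivSqZeroExt.snd h3).symm

theorem elt_add (a b c d a' b' c' d' : F) :
    elt a b c d + elt a' b' c' d' = elt (a + a') (b + b') (c + c') (d + d') := by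
  simp only [elt, map_add]; ring

theorem elt_mul (a b c d a' b' c' d' : F) :
    elt a b c d * elt a' b' c' d' = elt (a * a') (a * b' + b * a') (a * c' + c * a')
      (a * d' + d * a' + b * c' + c * b') := by
  simp only [elt, map_add, map_mul]
  linear_combination (exp := 1) (algebraMap F (BaseRing F) b + algebraMap F (BaseRing F) d * v F) *
    (algebraMap F (BaseRing F) b' + algebraMap F (BaseRing F) d' * v F) * u_mul_u (F := F) +
    (algebraMap F (BaseRing F) c + algebraMap F (BaseRing F) d * u F) *
    (algebraMap F (BaseRing F) c' + algebraMap F (BaseRing F) d' * u F) * v_mul_v (F := F) -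
    algebraMap F (BaseRing F) d * algebraMap F (BaseRing F) d' * u F * u F * v_mul_v (F := F)

theorem algebraMap_eq_elt (a : F) : algebraMap F (BaseRing F) a = elt a 0 0 0 := by
  simp [elt]

theorem u_eq_elt : u F = elt 0 1 0 0 := by simp [elt]

theorem v_eq_elt : v F = elt 0 0 1 0 := by simp [elt]

theorem exists_eq_elt (r : BaseRing F) : ∃ a b c d, r = elt a b c d := by
  obtain ⟨P, rfl⟩ := Ideal.Quotient.mk_surjective r
  induction P using MvPolynomial.induction_on with
  | C a => exact ⟨a, 0, 0, 0, algebraMap_eq_elt a⟩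
  | add P Q hP hQ =>
    obtain ⟨a, b, c, d, h⟩ := hP
    obtain ⟨a', b', c', d', h'⟩ := hQ
    rw [map_add, h, h', elt_add]
    exact ⟨_, _, _, _, rfl⟩
  | mul_X P i hP =>
    obtain ⟨a, b, c, d, h⟩ := hP
    fin_cases i
    · rw [map_mul, h]
      exact ⟨_, _, _, _, (congrArg _ u_eq_elt).trans (elt_mul ..)⟩
    · rw [map_mul, h]
      exact ⟨_, _, _, _, (congrArg _ v_eq_elt).trans (elt_mul ..)⟩

theorem exists_eq_u_mul {r : BaseRing F} (h : u F * r = 0) : ∃ r', r = u F * r' := by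
  obtain ⟨a, b, c, d, rfl⟩ := exists_eq_elt r
  rw [u_eq_elt, elt_mul] at h
  obtain ⟨-, h2, -, h4⟩ := elt_eq_zero h
  have ha : a = 0 := by simpa using h2
  have hc : c = 0 := by simpa using h4
  refine ⟨elt b 0 d 0, ?_⟩
  rw [u_eq_elt, elt_mul, ha, hc]
  simp

theorem u_mul_v_mul_eq_zero {a : F} (h : u F * v F * algebraMap F (BaseRing F) a = 0) : a = 0 := by
  rw [u_eq_elt, v_eq_elt, algebraMap_eq_elt, elt_mul, elt_mul] at h
  simpa using (elt_eq_zero h).2.2.2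

/-- A square root e of the residue lifts through the nilpotent part because 2e is invertible; the
coordinates are solved for successively. -/
theorem isSquare_elt (h2 : (2 : F) ≠ 0) {a b c d : F} (ha : a ≠ 0) (hsq : IsSquare a) :
    IsSquare (elt a b c d) := by
  obtain ⟨e, rfl⟩ := hsq
  have he : e ≠ 0 := left_ne_zero_of_mul ha
  refine ⟨elt e (b / (2 * e)) (c / (2 * e)) ((d - 2 * (b / (2 * e)) * (c / (2 * e))) / (2 * e)), ?_⟩
  rw [elt_mul]
  congr 1 <;> field_simp <;> ring

end BaseRing

/-! ### Pair weight against Hamming weight -/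

section PairDist

open Classical in
theorem pairDist_eq_card {A : Type*} [AddGroup A] {n : ℕ} (x y : Fin n → A) :
    pairDist x y = pairDist (x - y) 0 := by
  simp only [pairDist, ne_eq, Prod.mk.injEq, Pi.sub_apply, Pi.zero_apply, sub_eq_zero]

theorem pairDist_mul_le {A : Type*} [Ring A] {n : ℕ} (a : A) (x : Fin n → A) :
    pairDist (fun i => a * x i) 0 ≤ pairDist x 0 := by
  classical
  refine Finset.card_le_card fun i => ?_
  simp only [Finset.mem_filter, Finset.mem_univ, true_and, ne_eq, Prod.mk.injEq, Pi.zero_apply]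
  contrapose!
  rintro ⟨h1, h2⟩
  rw [h1, h2, mul_zero]
  exact ⟨rfl, rfl⟩

open Classical in
theorem pairDist_zero_le {A : Type*} [Zero A] {n : ℕ} (x : Fin n → A) :
    pairDist x 0 ≤ 2 * (Finset.univ.filter fun i => x i ≠ 0).card := by
  set S := Finset.univ.filter fun i => x i ≠ 0 with hS
  have hsub : (Finset.univ.filter fun i : Fin n =>
      (x i, x (finRotate n i)) ≠ ((0 : Fin n → A) i, (0 : Fin n → A) (finRotate n i))) ⊆
      S ∪ S.map (finRotate n).symm.toEmbedding := by
    intro i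
    simp only [Finset.mem_filter, Finset.mem_univ, true_and, ne_eq, Prod.mk.injEq, Pi.zero_apply,
      Finset.mem_union, Finset.mem_map_equiv, hS, Equiv.symm_symm]
    tauto
  refine (Finset.card_le_card hsub).trans ((Finset.card_union_le _ _).trans ?_)
  rw [Finset.card_map]
  omega

theorem finRotate_val_mod_two {n : ℕ} (hn : Even n) (i : Fin n) :
    (finRotate n i : ℕ) % 2 ≠ (i : ℕ) % 2 := by
  cases n with
  | zero => exact i.elim0
  | succ n =>
    rw [coe_finRotate]
    have hi := i.2
    obtain ⟨k, hk⟩ := hn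
    split_ifs with h
    · rw [h, Fin.val_last]; omega
    · omega

-- A nonzero entry is seen by the pair starting at it and by the one ending at it. For even n,
-- cyclic neighbours have opposite parity, so these pairs are all distinct when the entries have one
-- fixed parity.
open Classical in
theorem two_mul_card_parity_le_pairDist {A : Type*} [Zero A] {n : ℕ} (hn : Even n)
    (x : Fin n → A) (ε : ℕ) :
    2 * (Finset.univ.filter fun i : Fin n => x i ≠ 0 ∧ (i : ℕ) % 2 = ε).card ≤ pairDist x 0 := by
  set S := Finset.univ.filter fun i : Fin n => x i ≠ 0 ∧ (i : ℕ) % 2 = ε with hS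
  have hsub : S ∪ S.map (finRotate n).symm.toEmbedding ⊆ (Finset.univ.filter fun i : Fin n =>
      (x i, x (finRotate n i)) ≠ ((0 : Fin n → A) i, (0 : Fin n → A) (finRotate n i))) := by
    intro i
    simp only [Finset.mem_filter, Finset.mem_univ, true_and, ne_eq, Prod.mk.injEq, Pi.zero_apply,
      Finset.mem_union, Finset.mem_map_equiv, hS, Equiv.symm_symm]
    tauto
  have hdisj : Disjoint S (S.map (finRotate n).symm.toEmbedding) := by
    rw [Finset.disjoint_left]
    intro i hi hi'
    simp only [Finset.mem_filter, Finset.mem_univ, true_and, Finset.mem_map_equiv, hS,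
      Equiv.symm_symm] at hi hi'
    exact finRotate_val_mod_two hn i (hi'.2.trans hi.2.symm)
  have := Finset.card_le_card hsub
  rw [Finset.card_union_of_disjoint hdisj, Finset.card_map] at this
  rw [two_mul]
  exact this

theorem two_le_pairDist {A : Type*} [Zero A] {n : ℕ} (hn : Even n) {x : Fin n → A} (hx : x ≠ 0) :
    2 ≤ pairDist x 0 := by
  classical
  obtain ⟨i, hi⟩ := Function.ne_iff.1 hx
  refine le_trans ?_ (two_mul_card_parity_le_pairDist hn x ((i : ℕ) % 2))
  have : 0 < (Finset.univ.filter fun j : Fin n => x j ≠ 0 ∧ (j : ℕ) % 2 = (i : ℕ) % 2).card :=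
    Finset.card_pos.2 ⟨i, by simpa using hi⟩
  omega

end PairDist

/-! ### Words, their classes, and minimum pair weights -/

section Words

variable {A : Type*} [CommRing A] {n : ℕ} {α : A}

theorem wordClass_sub (x y : Fin n → A) :
    wordClass n α (x - y) = wordClass n α x - wordClass n α y := by
  rw [wordClass, wordClass, wordClass, ← map_sub, ← Finset.sum_sub_distrib]
  simp only [Pi.sub_apply, C_sub, sub_mul]

theorem wordClass_const_mul (a : A) (x : Fin n → A) :
    wordClass n α (fun i => a * x i) = AdjoinRoot.of (X ^ n - C α) a * wordClass n α x := by
  rw [wordClass, wordClass, ← AdjoinRoot.mk_C, ← map_mul, Finset.mul_sum]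
  simp only [C_mul, mul_assoc]

theorem eq_zero_of_wordClass_eq_zero (hn : n ≠ 0) {x : Fin n → A}
    (h : wordClass n α x = 0) : x = 0 := by
  nontriviality A
  have hdeg := degree_sum_fin_lt x
  have hP := (AdjoinRoot.mk_eq_zero.1 h)
  have hP0 : ∑ i : Fin n, C (x i) * X ^ (i : ℕ) = 0 := by
    by_contra hne
    refine (monic_X_pow_sub_C α hn).not_dvd_of_degree_lt hne ?_ hP
    rwa [degree_X_pow_sub_C (Nat.pos_of_ne_zero hn)]
  funext i
  have := congrArg (fun P => coeff P (i : ℕ)) hP0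
  simpa [finsetSum_coeff, coeff_C_mul, coeff_X_pow, Fin.val_inj] using this

theorem codePairDist_code (J : Ideal (Ambient n α)) : codePairDist (code J) =
    sInf {d : ℕ | ∃ c, wordClass n α c ∈ J ∧ c ≠ 0 ∧ pairDist c 0 = d} := by
  unfold codePairDist
  congr 1
  ext d
  constructor
  · rintro ⟨x, hx, y, hy, hne, h⟩
    refine ⟨x - y, ?_, sub_ne_zero.2 hne, by rw [← pairDist_eq_card, h]⟩
    rw [wordClass_sub]
    exact J.sub_mem hx hy
  · rintro ⟨c, hc, hne, h⟩
    exact ⟨c, hc, 0, by simp [code, wordClass], hne, h⟩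

theorem codePairDist_code_eq {J B : Ideal (Ambient n α)} (hBJ : B ≤ J)
    (h : ∀ c, wordClass n α c ∈ J → c ≠ 0 →
      ∃ c', wordClass n α c' ∈ B ∧ c' ≠ 0 ∧ pairDist c' 0 ≤ pairDist c 0) :
    codePairDist (code J) = codePairDist (code B) := by
  rw [codePairDist_code, codePairDist_code]
  have hsub : {d : ℕ | ∃ c, wordClass n α c ∈ B ∧ c ≠ 0 ∧ pairDist c 0 = d} ⊆
      {d : ℕ | ∃ c, wordClass n α c ∈ J ∧ c ≠ 0 ∧ pairDist c 0 = d} :=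
    fun d ⟨c, hc, h⟩ => ⟨c, hBJ hc, h⟩
  -- If J has no nonzero codeword, neither has B, and both infima take the default value 0.
  rcases Set.eq_empty_or_nonempty
    {d : ℕ | ∃ c, wordClass n α c ∈ J ∧ c ≠ 0 ∧ pairDist c 0 = d} with he | hne
  · rw [he, Set.subset_empty_iff.1 (hsub.trans he.subset)]
  · obtain ⟨c, hc, hc0, hcd⟩ := Nat.sInf_mem hne
    obtain ⟨c', hc', hc0', hle⟩ := h c hc hc0
    have hmem : pairDist c' 0 ∈ {d : ℕ | ∃ c, wordClass n α c ∈ B ∧ c ≠ 0 ∧ pairDist c 0 = d} :=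
      ⟨c', hc', hc0', rfl⟩
    refine le_antisymm (Nat.sInf_le (hsub (Nat.sInf_mem ⟨_, hmem⟩))) ?_
    rw [← hcd]
    exact (Nat.sInf_le hmem).trans hle

theorem codePairDist_code_eq_of_forall_le {J : Ideal (Ambient n α)} {d : ℕ}
    (h : ∀ c, wordClass n α c ∈ J → c ≠ 0 → d ≤ pairDist c 0)
    {c : Fin n → A} (hc : wordClass n α c ∈ J) (hc0 : c ≠ 0) (hd : pairDist c 0 ≤ d) :
    codePairDist (code J) = d := by
  rw [codePairDist_code]
  have hmem : pairDist c 0 ∈ {d : ℕ | ∃ c, wordClass n α c ∈ J ∧ c ≠ 0 ∧ pairDist c 0 = d} :=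
    ⟨c, hc, hc0, rfl⟩
  refine le_antisymm ((Nat.sInf_le hmem).trans hd) (le_csInf ⟨_, hmem⟩ ?_)
  rintro _ ⟨c, hc, hc0, rfl⟩
  exact h c hc hc0

end Words

/-! ### The local ambient ring and the chain of multiples of u -/

section Chain

variable {F : Type*} [Field F] {n : ℕ} {α : BaseRing F}

/-- The class of a polynomial with coefficients in `F`. -/
def ofPoly (n : ℕ) (α : BaseRing F) : F[X] →+* Ambient n α :=
  (AdjoinRoot.mk (X ^ n - C α)).comp (mapRingHom (algebraMap F (BaseRing F)))

theorem ofPoly_C (a : F) :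
    ofPoly n α (C a) = AdjoinRoot.of (X ^ n - C α) (algebraMap F (BaseRing F) a) := by
  simp [ofPoly]

theorem quad_eq_ofPoly (α₀ : F) : quad n α α₀ = ofPoly n α (X ^ 2 - C α₀) := by
  simp [quad, ofPoly]

theorem exists_eq_ofPoly_add (e : Ambient n α) : ∃ P e₁ e₂, e = ofPoly n α P +
    uClass n α * e₁ + AdjoinRoot.of (X ^ n - C α) (v F) * e₂ := by
  obtain ⟨P, rfl⟩ := AdjoinRoot.mk_surjective e
  induction P using Polynomial.induction_on' with
  | add P Q hP hQ =>
    obtain ⟨P', e₁, e₂, h⟩ := hP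
    obtain ⟨Q', f₁, f₂, h'⟩ := hQ
    refine ⟨P' + Q', e₁ + f₁, e₂ + f₂, ?_⟩
    rw [map_add, map_add, h, h']
    ring
  | monomial k r =>
    obtain ⟨a, b, c, d, rfl⟩ := exists_eq_elt r
    refine ⟨monomial k a, ofPoly n α (monomial k b), ofPoly n α (monomial k c) +
      uClass n α * ofPoly n α (monomial k d), ?_⟩
    simp only [← C_mul_X_pow_eq_monomial, map_mul, ofPoly_C, map_pow, AdjoinRoot.mk_C, elt,
      map_add, uClass]
    have : ofPoly n α X = AdjoinRoot.mk (X ^ n - C α) X := by simp [ofPoly]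
    rw [this]
    ring

theorem quad_pow_char_pow {p s : ℕ} [Fact p.Prime] [CharP F p] {α₀ a₁ a₂ a₃ a₄ : F}
    (hα : α = elt a₁ a₂ a₃ a₄) (hα₀ : α₀ ^ p ^ s = a₁) :
    quad (2 * p ^ s) α α₀ ^ p ^ s = AdjoinRoot.of (X ^ (2 * p ^ s) - C α) (elt 0 a₂ a₃ a₄) := by
  rw [quad_eq_ofPoly, ← map_pow, sub_pow_char_pow, ← C_pow, hα₀, ← pow_mul]
  have h : elt 0 a₂ a₃ a₄ = α - algebraMap F (BaseRing F) a₁ := by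
    rw [hα]; simp [elt]; ring
  have h0 : AdjoinRoot.mk (X ^ (2 * p ^ s) - C α) (X ^ (2 * p ^ s) - C α) = 0 :=
    AdjoinRoot.mk_self
  rw [h, ← AdjoinRoot.mk_C]
  simp only [ofPoly, RingHom.comp_apply, coe_mapRingHom, Polynomial.map_pow, map_X, map_C,
    map_sub] at h0 ⊢
  linear_combination h0

/-- Modulo the nilpotents u and v, an element is a polynomial P over F. If f ∤ P, then P is
invertible modulo the nilpotent f; if f ∣ P, only the v part remains, and v ∈ ⟨f, u⟩. -/
theorem isUnit_or_exists_eq {α₀ a₂ a₃ a₄ : F} {N : ℕ} (hN : N ≠ 0)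
    (hirr : Irreducible (X ^ 2 - C α₀ : F[X])) (ha₃ : a₃ ≠ 0)
    (hquad : quad n α α₀ ^ N = AdjoinRoot.of (X ^ n - C α) (elt 0 a₂ a₃ a₄)) (e : Ambient n α) :
    IsUnit e ∨ ∃ a b, e = quad n α α₀ * a + uClass n α * b := by
  set V := AdjoinRoot.of (X ^ n - C α) (v F) with hV
  have hu : uClass n α ∈ nilradical (Ambient n α) :=
    mem_nilradical.2 ⟨2, (pow_two _).trans (by rw [uClass, ← map_mul, u_mul_u, map_zero])⟩
  have hv : V ∈ nilradical (Ambient n α) :=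
    mem_nilradical.2 ⟨2, (pow_two _).trans (by rw [hV, ← map_mul, v_mul_v, map_zero])⟩
  have hquad' : quad n α α₀ ^ N = ofPoly n α (C a₂) * uClass n α + ofPoly n α (C a₃) * V +
      ofPoly n α (C a₄) * (uClass n α * V) := by
    rw [hquad]
    simp only [elt, map_add, map_mul, map_zero, zero_add, ofPoly_C, uClass, hV]
  have hf : quad n α α₀ ∈ nilradical (Ambient n α) := by
    suffices h : quad n α α₀ ^ N ∈ nilradical (Ambient n α) by
      obtain ⟨k, hk⟩ := mem_nilradical.1 h
      exact mem_nilradical.2 ⟨N * k, by rw [pow_mul, hk]⟩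
    rw [hquad']
    exact add_mem (add_mem (Ideal.mul_mem_left _ _ hu) (Ideal.mul_mem_left _ _ hv))
      (Ideal.mul_mem_left _ _ (Ideal.mul_mem_left _ _ hv))
  -- This is f^N = a₂u + a₃v + a₄uv solved for v.
  have hVeq : V = quad n α α₀ * (quad n α α₀ ^ (N - 1) * ofPoly n α (C a₃⁻¹)) +
      uClass n α * (-(ofPoly n α (C a₃⁻¹) * (ofPoly n α (C a₂) + ofPoly n α (C a₄) * V))) := by
    have h1 : ofPoly n α (C a₃⁻¹) * ofPoly n α (C a₃) = 1 := by
      rw [← map_mul, ← C_mul, inv_mul_cancel₀ ha₃, C_1, map_one]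
    rw [← mul_assoc, mul_pow_sub_one hN, hquad']
    linear_combination (-V) * h1
  obtain ⟨P, e₁, e₂, rfl⟩ := exists_eq_ofPoly_add e
  by_cases hdvd : X ^ 2 - C α₀ ∣ P
  swap
  · left
    have hcop := hirr.coprime_iff_not_dvd.2 hdvd
    obtain ⟨A, B, hAB⟩ := hcop
    have h1 : ofPoly n α A * quad n α α₀ + ofPoly n α B * ofPoly n α P = 1 := by
      rw [quad_eq_ofPoly, ← map_mul, ← map_mul, ← map_add, hAB, map_one]
    refine isUnit_of_mul_isUnit_right (x := ofPoly n α B) ?_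
    have h2 : ofPoly n α B * (ofPoly n α P + uClass n α * e₁ + V * e₂) = 1 +
        (-(ofPoly n α A) * quad n α α₀ + ofPoly n α B * e₁ * uClass n α +
          ofPoly n α B * e₂ * V) := by
      linear_combination h1
    rw [h2]
    refine IsNilpotent.isUnit_one_add (mem_nilradical.1 ?_)
    exact add_mem (add_mem (Ideal.mul_mem_left _ _ hf) (Ideal.mul_mem_left _ _ hu))
      (Ideal.mul_mem_left _ _ hv)
  · right
    obtain ⟨Q, rfl⟩ := hdvd
    rw [map_mul, ← quad_eq_ofPoly]
    set a := quad n α α₀ ^ (N - 1) * ofPoly n α (C a₃⁻¹)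
    set b := -(ofPoly n α (C a₃⁻¹) * (ofPoly n α (C a₂) + ofPoly n α (C a₄) * V))
    refine ⟨ofPoly n α Q + a * e₂, e₁ + b * e₂, ?_⟩
    linear_combination e₂ * hVeq

theorem uClass_mul_uClass : uClass n α * uClass n α = 0 := by
  rw [uClass, ← map_mul, u_mul_u, map_zero]

/-- The class of the constant `uv`. -/
def uvClass (n : ℕ) (α : BaseRing F) : Ambient n α :=
  AdjoinRoot.of (X ^ n - C α) (u F * v F)

theorem uvClass_mul_uClass : uvClass n α * uClass n α = 0 := by
  rw [uvClass, uClass, ← map_mul]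
  have : u F * v F * u F = 0 := by linear_combination v F * u_mul_u (F := F)
  rw [this, map_zero]

theorem uvClass_mul_vClass : uvClass n α * AdjoinRoot.of (X ^ n - C α) (v F) = 0 := by
  rw [uvClass, ← map_mul]
  have : u F * v F * v F = 0 := by linear_combination u F * v_mul_v (F := F)
  rw [this, map_zero]

theorem uClass_mul_quad_pow {α₀ a₂ a₃ a₄ : F} {N : ℕ}
    (hquad : quad n α α₀ ^ N = AdjoinRoot.of (X ^ n - C α) (elt 0 a₂ a₃ a₄)) :
    uClass n α * quad n α α₀ ^ N =
      uvClass n α * ofPoly n α (C a₃) := by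
  rw [hquad, uClass, uvClass, ofPoly_C, ← map_mul, ← map_mul]
  congr 1
  rw [u_eq_elt, v_eq_elt, algebraMap_eq_elt, elt_mul, elt_mul, elt_mul]
  simp

theorem uvClass_mul_quad_pow {α₀ a₂ a₃ a₄ : F} {N : ℕ}
    (hquad : quad n α α₀ ^ N = AdjoinRoot.of (X ^ n - C α) (elt 0 a₂ a₃ a₄)) :
    uvClass n α * quad n α α₀ ^ N = 0 := by
  rw [hquad, uvClass, ← map_mul, u_eq_elt, v_eq_elt, elt_mul, elt_mul]
  simp [elt]

theorem uClass_mul_mem_idealB {α₀ a₂ a₃ a₄ : F} {N : ℕ} (hN : N ≠ 0)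
    (hirr : Irreducible (X ^ 2 - C α₀ : F[X])) (ha₃ : a₃ ≠ 0)
    (hquad : quad n α α₀ ^ N = AdjoinRoot.of (X ^ n - C α) (elt 0 a₂ a₃ a₄))
    {J : Ideal (Ambient n α)} {I : ℕ}
    (hI : IsLeast {k : ℕ | uClass n α * quad n α α₀ ^ k ∈ J} I) {e : Ambient n α}
    (he : uClass n α * e ∈ J) : uClass n α * e ∈ idealB n α α₀ I := by
  have key : ∀ k : ℕ, (∃ e', uClass n α * e = uClass n α * (quad n α α₀ ^ k * e')) ∨
      ∃ j w, IsUnit w ∧ uClass n α * e = uClass n α * (quad n α α₀ ^ j * w) := by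
    intro k
    induction k with
    | zero => exact Or.inl ⟨e, by simp⟩
    | succ k ih =>
      rcases ih with ⟨e', h⟩ | h
      · rcases isUnit_or_exists_eq hN hirr ha₃ hquad e' with hw | ⟨a, b, rfl⟩
        · exact Or.inr ⟨k, e', hw, h⟩
        · refine Or.inl ⟨a, ?_⟩
          rw [h]
          linear_combination (quad n α α₀ ^ k * b) * uClass_mul_uClass (n := n) (α := α)
      · exact Or.inr h
  -- The exponent 2N suffices because u f^(2N) = a₃uv f^N = 0. In the unit case u f^j itself lies in
  -- J, so minimality gives I ≤ j.
  rcases key (N + N) with ⟨e', h⟩ | ⟨j, w, hw, h⟩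
  · have h0 : uClass n α * e = 0 := by
      have h1 := uClass_mul_quad_pow hquad
      have h2 := uvClass_mul_quad_pow hquad
      rw [h, pow_add]
      linear_combination (quad n α α₀ ^ N * e') * h1 + ofPoly n α (C a₃) * e' * h2
    rw [h0]
    exact zero_mem _
  · rw [h] at he ⊢
    rw [← mul_assoc] at he ⊢
    have hle := hI.2 ((Ideal.mul_unit_mem_iff_mem J hw).1 he)
    refine Ideal.mul_mem_right _ _ (Ideal.mem_span_singleton.2 ?_)
    exact mul_dvd_mul_left _ (pow_dvd_pow _ hle)

theorem codePairDist_eq_idealB {α₀ a₂ a₃ a₄ : F} {N : ℕ} (hN : N ≠ 0)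
    (hirr : Irreducible (X ^ 2 - C α₀ : F[X])) (ha₃ : a₃ ≠ 0)
    (hquad : quad n α α₀ ^ N = AdjoinRoot.of (X ^ n - C α) (elt 0 a₂ a₃ a₄))
    {J : Ideal (Ambient n α)} {I : ℕ}
    (hI : IsLeast {k : ℕ | uClass n α * quad n α α₀ ^ k ∈ J} I) :
    codePairDist (code J) = codePairDist (code (idealB n α α₀ I)) := by
  refine codePairDist_code_eq ((Ideal.span_singleton_le_iff_mem _).2 hI.1) fun c hc hc0 => ?_
  by_cases huc : (fun i => u F * c i) = 0
  · have h : ∀ i, ∃ r, c i = u F * r := fun i => exists_eq_u_mul (congrFun huc i)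
    choose c' hc' using h
    obtain rfl : c = fun i => u F * c' i := funext hc'
    refine ⟨_, ?_, hc0, le_rfl⟩
    rw [wordClass_const_mul] at hc ⊢
    exact uClass_mul_mem_idealB hN hirr ha₃ hquad hI hc
  · refine ⟨_, ?_, huc, pairDist_mul_le _ _⟩
    rw [wordClass_const_mul]
    exact uClass_mul_mem_idealB hN hirr ha₃ hquad hI (J.mul_mem_left _ hc)

end Chain

/-! ### Words uv·Q and the pair distance of ⟨u f^k⟩ -/

section SocleWords

variable {F : Type*} [Field F] {n : ℕ} {α : BaseRing F}

/-- The word of `uv Q`, for a polynomial `Q` over `F`. -/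
def socleWord (n : ℕ) (Q : F[X]) : Fin n → BaseRing F :=
  fun i => u F * v F * algebraMap F (BaseRing F) (Q.coeff i)

theorem socleWord_apply_ne_zero_iff {Q : F[X]} {i : Fin n} :
    socleWord n Q i ≠ 0 ↔ Q.coeff i ≠ 0 := by
  refine not_congr ⟨u_mul_v_mul_eq_zero, fun h => ?_⟩
  rw [socleWord, h, map_zero, mul_zero]

theorem wordClass_socleWord {Q : F[X]} (hQ : Q.natDegree < n) :
    wordClass n α (socleWord n Q) =
      uvClass n α * ofPoly n α Q := by
  unfold socleWord
  rw [uvClass, wordClass_const_mul, ofPoly, wordClass, RingHom.comp_apply]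
  congr 2
  rw [Fin.sum_univ_eq_sum_range
    (fun i => C (algebraMap F (BaseRing F) (Q.coeff i)) * X ^ i) n]
  conv_rhs => rw [Q.as_sum_range' n hQ]
  simp [← C_mul_X_pow_eq_monomial]

theorem socleWord_ne_zero {Q : F[X]} (hQ0 : Q ≠ 0) (hQ : Q.natDegree < n) :
    socleWord n Q ≠ 0 := by
  intro h
  refine (socleWord_apply_ne_zero_iff (n := n) (Q := Q) (i := ⟨Q.natDegree, hQ⟩)).2 ?_
    (by rw [h]; rfl)
  simpa using hQ0

theorem pairDist_socleWord_le (Q : F[X]) : pairDist (socleWord n Q) 0 ≤ 2 * Q.support.card := by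
  classical
  refine (pairDist_zero_le _).trans (Nat.mul_le_mul_left 2 ?_)
  refine Finset.card_le_card_of_injOn (fun i : Fin n => (i : ℕ)) ?_
    (Fin.val_injective.injOn)
  intro i hi
  simpa [socleWord_apply_ne_zero_iff] using hi

theorem two_mul_card_support_le_pairDist (hn : Even n) {Q A : F[X]} (hQ : Q.natDegree < n)
    {ε : ℕ} (hε : ε < 2) (hA : ∀ k, A.coeff k = Q.coeff (2 * k + ε)) :
    2 * A.support.card ≤ pairDist (socleWord n Q) 0 := by
  classical
  refine le_trans (Nat.mul_le_mul_left 2 ?_) (two_mul_card_parity_le_pairDist hn _ ε)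
  have hsub : A.support.image (fun k => 2 * k + ε) ⊆ (Finset.univ.filter fun i : Fin n =>
      socleWord n Q i ≠ 0 ∧ (i : ℕ) % 2 = ε).map Fin.valEmbedding := by
    intro i hi
    obtain ⟨k, hk, rfl⟩ := Finset.mem_image.1 hi
    rw [mem_support_iff, hA] at hk
    refine Finset.mem_map.2 ⟨⟨2 * k + ε, (le_natDegree_of_ne_zero hk).trans_lt hQ⟩, ?_, rfl⟩
    simp only [Finset.mem_filter, Finset.mem_univ, true_and, socleWord_apply_ne_zero_iff]
    exact ⟨hk, by omega⟩
  have := Finset.card_le_card hsub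
  rwa [Finset.card_map, Finset.card_image_of_injective] at this
  intro a b hab
  simp only at hab
  omega

/-- Multiplication by uv sees only the F-part P of the cofactor. Since uv f^N = 0, the polynomial
a₃f^jP may be reduced modulo f^N, of degree n; j ≤ N keeps it divisible by f^j. -/
theorem exists_eq_socleWord {α₀ a₂ a₃ a₄ : F} {N j : ℕ} (hn : n = 2 * N) (hN : N ≠ 0)
    (hj : j ≤ N)
    (hquad : quad n α α₀ ^ N = AdjoinRoot.of (X ^ n - C α) (elt 0 a₂ a₃ a₄))
    {c : Fin n → BaseRing F} (hc : wordClass n α c ∈ idealB n α α₀ (N + j)) :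
    ∃ Q : F[X], Q.natDegree < n ∧ (X ^ 2 - C α₀) ^ j ∣ Q ∧ c = socleWord n Q := by
  obtain ⟨e, he⟩ := Ideal.mem_span_singleton.1 hc
  obtain ⟨P, e₁, e₂, rfl⟩ := exists_eq_ofPoly_add e
  set f : F[X] := X ^ 2 - C α₀ with hf
  have hfm : f.Monic := monic_X_pow_sub_C α₀ two_ne_zero
  set Q₀ := C a₃ * f ^ j * P with hQ₀
  have hdeg : (f ^ N).natDegree = n := by
    rw [hfm.natDegree_pow, hf, natDegree_X_pow_sub_C, hn, mul_comm]
  have hQdeg : (Q₀ %ₘ f ^ N).natDegree < n := by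
    rw [← hdeg]
    refine natDegree_modByMonic_lt _ (hfm.pow N) fun h1 => ?_
    rw [h1, natDegree_one] at hdeg
    omega
  refine ⟨Q₀ %ₘ f ^ N, hQdeg, ?_, ?_⟩
  · rw [modByMonic_eq_sub_mul_div]
    exact dvd_sub (((dvd_refl (f ^ j)).mul_left _).mul_right _ : f ^ j ∣ Q₀)
      ((pow_dvd_pow _ hj).mul_right _)
  · rw [← sub_eq_zero]
    refine eq_zero_of_wordClass_eq_zero (α := α) (by omega) ?_
    rw [wordClass_sub, wordClass_socleWord hQdeg, he, modByMonic_eq_sub_mul_div]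
    have h1 := uClass_mul_quad_pow hquad
    have h2 := uvClass_mul_quad_pow hquad
    have hu := uvClass_mul_uClass (n := n) (α := α)
    have hv := uvClass_mul_vClass (n := n) (α := α)
    rw [map_sub, map_mul (ofPoly n α) (f ^ N), map_pow, ← quad_eq_ofPoly, map_mul (ofPoly n α) _ P,
      map_mul (ofPoly n α) (C a₃), map_pow, ← quad_eq_ofPoly, pow_add]
    linear_combination (quad n α α₀ ^ j * (ofPoly n α P + uClass n α * e₁ +
      AdjoinRoot.of (X ^ n - C α) (v F) * e₂)) * h1 + ofPoly n α (Q₀ /ₘ f ^ N) * h2 +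
      ofPoly n α (C a₃) * quad n α α₀ ^ j * e₁ * hu +
      ofPoly n α (C a₃) * quad n α α₀ ^ j * e₂ * hv

theorem wordClass_socleWord_mem {α₀ a₂ a₃ a₄ : F} {N i : ℕ} {Q : F[X]} (ha₃ : a₃ ≠ 0)
    (hquad : quad n α α₀ ^ N = AdjoinRoot.of (X ^ n - C α) (elt 0 a₂ a₃ a₄))
    (hQ : Q.natDegree < n) {j : ℕ} (hi : i ≤ N + j) (hdvd : (X ^ 2 - C α₀) ^ j ∣ Q) :
    wordClass n α (socleWord n Q) ∈ idealB n α α₀ i := by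
  obtain ⟨P, rfl⟩ := hdvd
  rw [wordClass_socleWord hQ]
  refine Ideal.mem_span_singleton.2 ((mul_dvd_mul_left _ (pow_dvd_pow _ hi)).trans
    ⟨ofPoly n α (C a₃⁻¹ * P), ?_⟩)
  have h1 : ofPoly n α (C a₃⁻¹) * ofPoly n α (C a₃) = 1 := by
    rw [← map_mul, ← C_mul, inv_mul_cancel₀ ha₃, C_1, map_one]
  rw [pow_add, ← mul_assoc, uClass_mul_quad_pow hquad, map_mul (ofPoly n α) _ P,
    map_mul (ofPoly n α) _ P, map_pow, ← quad_eq_ofPoly]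
  linear_combination -(uvClass n α) * quad n α α₀ ^ j *
    ofPoly n α P * h1

theorem X_sq_sub_C_pow_eq_expand (a : F) (j : ℕ) :
    (X ^ 2 - C a : F[X]) ^ j = expand F 2 ((X - C a) ^ j) := by
  simp

/-- As f^j is a polynomial in X², extracting the even part commutes with multiplication by it. The
odd part of Q is, up to a factor X coprime to X - a, the even part of XQ. -/
theorem exists_half {a : F} (ha : a ≠ 0) {Q : F[X]} {N j : ℕ} (hQ0 : Q ≠ 0)
    (hQ : Q.natDegree < 2 * N) (hdvd : (X ^ 2 - C a) ^ j ∣ Q) :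
    ∃ A : F[X], A ≠ 0 ∧ A.natDegree < N ∧ (X - C a) ^ j ∣ A ∧
      ∃ ε < 2, ∀ k, A.coeff k = Q.coeff (2 * k + ε) := by
  have hcontract : ∀ R : F[X], (X ^ 2 - C a) ^ j ∣ R → (X - C a) ^ j ∣ contract 2 R := by
    rintro R ⟨P, rfl⟩
    rw [X_sq_sub_C_pow_eq_expand, mul_comm, contract_mul_expand two_ne_zero]
    exact Dvd.intro_left _ rfl
  have hAdeg : ∀ (A : F[X]) (ε : ℕ), A ≠ 0 → (∀ k, A.coeff k = Q.coeff (2 * k + ε)) →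
      A.natDegree < N := by
    intro A ε hA h
    have h1 : A.coeff A.natDegree ≠ 0 := by simpa using hA
    rw [h] at h1
    have := le_natDegree_of_ne_zero h1
    omega
  have h0 : ∀ k, (contract 2 Q).coeff k = Q.coeff (2 * k + 0) := fun k => by
    rw [coeff_contract two_ne_zero, mul_comm, add_zero]
  set B := contract 2 (X * Q) with hB
  have h1 : ∀ k, B.divX.coeff k = Q.coeff (2 * k + 1) := fun k => by
    rw [coeff_divX, hB, coeff_contract two_ne_zero,
      show (k + 1) * 2 = 2 * k + 1 + 1 by ring, coeff_X_mul]
  by_cases hA : contract 2 Q = 0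
  · have hne : B.divX ≠ 0 := by
      intro hz
      apply hQ0
      ext i
      rcases Nat.even_or_odd' i with ⟨k, rfl | rfl⟩
      · rw [← add_zero (2 * k), ← h0, hA]
        simp
      · rw [← h1, hz]
        simp
    refine ⟨B.divX, hne, hAdeg _ 1 hne h1, ?_, 1, one_lt_two, h1⟩
    have hBX : B.divX * X = B := by
      have := B.divX_mul_X_add
      rwa [hB, coeff_contract two_ne_zero, zero_mul, coeff_X_mul_zero, C_0, add_zero] at this
    have hcop : IsCoprime ((X - C a) ^ j) X := by
      refine IsCoprime.pow_left ⟨-C a⁻¹, C a⁻¹, ?_⟩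
      have : C a⁻¹ * C a = (1 : F[X]) := by rw [← C_mul, inv_mul_cancel₀ ha, C_1]
      linear_combination this
    refine hcop.dvd_of_dvd_mul_right ?_
    rw [hBX]
    exact hcontract _ (hdvd.mul_left _)
  · exact ⟨_, hA, hAdeg _ 0 hA h0, hcontract _ hdvd, 0, two_pos, h0⟩

theorem codePairDist_idealB_of_le {α₀ a₂ a₃ a₄ : F} {N I : ℕ} (hn : n = 2 * N) (hN : N ≠ 0)
    (ha₃ : a₃ ≠ 0)
    (hquad : quad n α α₀ ^ N = AdjoinRoot.of (X ^ n - C α) (elt 0 a₂ a₃ a₄)) (hI : I ≤ N) :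
    codePairDist (code (idealB n α α₀ I)) = 2 := by
  have hdeg : (1 : F[X]).natDegree < n := by rw [natDegree_one]; omega
  refine codePairDist_code_eq_of_forall_le
    (fun c _ hc => two_le_pairDist ⟨N, by omega⟩ hc)
    (wordClass_socleWord_mem (j := 0) (Q := 1) ha₃ hquad hdeg (by omega) (by simp))
    (socleWord_ne_zero one_ne_zero hdeg) ((pairDist_socleWord_le _).trans ?_)
  have := card_supp_le_succ_natDegree (1 : F[X])
  rw [natDegree_one] at this
  omega

theorem codePairDist_idealB_of_lt {p r γ k j : ℕ} [Fact p.Prime] [CharP F p]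
    {α₀ a₂ a₃ a₄ : F} (hn : n = 2 * p ^ (r + 1 + γ)) (hα₀ : α₀ ≠ 0) (ha₃ : a₃ ≠ 0)
    (hquad : quad n α α₀ ^ p ^ (r + 1 + γ) = AdjoinRoot.of (X ^ n - C α) (elt 0 a₂ a₃ a₄))
    (hk : k + 1 < p) (hj : p ^ (r + 1) * (p ^ γ - 1) + k * p ^ r + 1 ≤ j)
    (hj' : j ≤ p ^ (r + 1) * (p ^ γ - 1) + (k + 1) * p ^ r) :
    codePairDist (code (idealB n α α₀ (p ^ (r + 1 + γ) + j))) = 2 * (k + 2) * p ^ γ := by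
  have hp : p.Prime := Fact.out
  have hN0 : p ^ (r + 1 + γ) ≠ 0 := pow_ne_zero _ hp.ne_zero
  -- T is the top of the range for j, so f^T gives a word in every ideal of the range; it has few
  -- enough terms to attain the lower bound.
  set T := p ^ (r + 1) * (p ^ γ - 1) + (k + 1) * p ^ r with hT
  have hTN : T < p ^ (r + 1 + γ) := by
    have h1 : 1 ≤ p ^ γ := Nat.one_le_pow _ _ hp.pos
    have h2 : p ^ (r + 1 + γ) = p ^ (r + 1) * (p ^ γ - 1) + p * p ^ r := by
      zify [h1]
      ring
    have h3 : (k + 1) * p ^ r < p * p ^ r := Nat.mul_lt_mul_of_pos_right hk (pow_pos hp.pos r)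
    omega
  have hdeg : ((X ^ 2 - C α₀) ^ T : F[X]).natDegree < n := by
    rw [(monic_X_pow_sub_C α₀ two_ne_zero).natDegree_pow, natDegree_X_pow_sub_C]
    omega
  refine codePairDist_code_eq_of_forall_le (fun c hc hc0 => ?_)
    (wordClass_socleWord_mem (j := T) (Q := (X ^ 2 - C α₀) ^ T) ha₃ hquad hdeg (by omega) dvd_rfl)
    (socleWord_ne_zero (pow_ne_zero _ (monic_X_pow_sub_C α₀ two_ne_zero).ne_zero) hdeg)
    ((pairDist_socleWord_le _).trans ?_)
  · obtain ⟨Q, hQ, hdvd, rfl⟩ := exists_eq_socleWord hn hN0 (by omega) hquad hc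
    have hQ0 : Q ≠ 0 := by
      rintro rfl
      exact hc0 (funext fun i => by simp [socleWord])
    obtain ⟨A, hA0, hA, hAdvd, ε, hε, hcoeff⟩ := exists_half hα₀ hQ0 (hn ▸ hQ) hdvd
    rw [mul_assoc]
    exact (Nat.mul_le_mul_left 2 (mul_pow_le_card_support p r k hα₀ γ A hA0 hA
      ((pow_dvd_pow _ hj).trans hAdvd))).trans
      (two_mul_card_support_le_pairDist ⟨p ^ (r + 1 + γ), by omega⟩ hQ hε hcoeff)
  · rw [X_sq_sub_C_pow_eq_expand, mul_assoc]
    exact Nat.mul_le_mul_left 2 ((card_support_expand_le two_pos _).trans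
      (card_support_X_sub_C_pow_le p r (k + 1) γ α₀))

end SocleWords

/-! ### The characteristic and the p^s-th root of α₁ -/

section Field

theorem charP_of_card {F : Type*} [Field F] [Finite F] {p m : ℕ} (hp : p.Prime) (hm : 1 ≤ m)
    (hF : Nat.card F = p ^ m) : CharP F p := by
  have := Fintype.ofFinite F
  obtain ⟨q, hq⟩ := CharP.exists F
  obtain ⟨k, hqp, hk⟩ := FiniteField.card F q
  rw [← Nat.card_eq_fintype_card, hF] at hk
  have h1 : p ∣ q := hp.dvd_of_dvd_pow (hk ▸ dvd_pow_self p (by omega))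
  rwa [(Nat.prime_dvd_prime_iff_eq hp hqp).1 h1]

theorem alphaZero_pow {F : Type*} [Field F] [Finite F] {p m s : ℕ} (hm : 1 ≤ m)
    (hF : Nat.card F = p ^ m) (a : F) : alphaZero p m s a ^ p ^ s = a := by
  have := Fintype.ofFinite F
  rw [Nat.card_eq_fintype_card] at hF
  -- The total exponent of p is a multiple of m, so this iterate of the Frobenius is the identity on
  -- F.
  have h1 : m - s % m + s = m * (s / m + 1) := by
    have := Nat.mod_lt s hm
    have := Nat.div_add_mod s m
    rw [mul_add]
    omega
  rw [alphaZero, ← pow_mul, ← pow_add, h1, pow_mul, ← hF]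
  exact FiniteField.pow_card_pow _ _

end Field

end Constacyclic

end

theorem theorem13 {F : Type*} [Field F] [Finite F] (p m s : ℕ) (hp : p.Prime) (hp2 : p ≠ 2)
    (hm : 1 ≤ m) (hs : 1 ≤ s) (hF : Nat.card F = p ^ m)
    (α₁ α₂ α₃ α₄ : F) (h₁ : α₁ ≠ 0) (h₂ : α₂ ≠ 0) (h₃ : α₃ ≠ 0)
    (α : Constacyclic.BaseRing F) (hα : α = Constacyclic.elt α₁ α₂ α₃ α₄)
    (hsq : ¬ IsSquare α)
    (α₀ : F) (hα₀ : α₀ = Constacyclic.alphaZero p m s α₁)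
    (l t : ℕ) (hl : l ≤ 2 * p ^ s - 1) (ht : t < l)
    (z : Constacyclic.Ambient (2 * p ^ s) α) (hz : z = 0 ∨ IsUnit z)
    (I : ℕ)
    (hI : IsLeast {k : ℕ | Constacyclic.uClass (2 * p ^ s) α *
        Constacyclic.quad (2 * p ^ s) α α₀ ^ k ∈
          Constacyclic.idealC (2 * p ^ s) α α₀ l t z} I) :
    Constacyclic.codePairDist
        (Constacyclic.code (Constacyclic.idealC (2 * p ^ s) α α₀ l t z)) =
      Constacyclic.codePairDist
        (Constacyclic.code (Constacyclic.idealB (2 * p ^ s) α α₀ I)) ∧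
    (I ≤ p ^ s →
      Constacyclic.codePairDist
        (Constacyclic.code (Constacyclic.idealC (2 * p ^ s) α α₀ l t z)) = 2) ∧
    (∀ Γ γ : ℕ, 1 ≤ Γ → Γ ≤ p - 1 → γ ≤ s - 1 →
      2 * p ^ s - p ^ (s - γ) + (Γ - 1) * p ^ (s - γ - 1) + 1 ≤ I →
      I ≤ 2 * p ^ s - p ^ (s - γ) + Γ * p ^ (s - γ - 1) →
      Constacyclic.codePairDist
        (Constacyclic.code (Constacyclic.idealC (2 * p ^ s) α α₀ l t z)) =
          2 * (Γ + 1) * p ^ γ) := by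
  have : Fact p.Prime := ⟨hp⟩
  have : CharP F p := Constacyclic.charP_of_card hp hm hF
  have hpow : α₀ ^ p ^ s = α₁ := by rw [hα₀, Constacyclic.alphaZero_pow hm hF]
  have hN : p ^ s ≠ 0 := pow_ne_zero _ hp.ne_zero
  have hα₀0 : α₀ ≠ 0 := by
    rintro rfl
    exact h₁ (by rw [← hpow, zero_pow hN])
  have htwo : (2 : F) ≠ 0 := Ring.two_ne_zero (by rwa [ringChar.eq F p])
  have hirr : Irreducible (Polynomial.X ^ 2 - Polynomial.C α₀ : Polynomial F) := by
    -- A square root of α₀ would make α₁ = α₀^(p^s) a square, and this would lift to α.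
    refine X_pow_sub_C_irreducible_of_prime Nat.prime_two fun b hb => hsq ?_
    have h : IsSquare α₀ := ⟨b, by rw [← hb, pow_two]⟩
    exact hα ▸ Constacyclic.isSquare_elt htwo h₁ (hpow ▸ h.pow (p ^ s))
  have hquad := Constacyclic.quad_pow_char_pow (p := p) (s := s) hα hpow
  rw [Constacyclic.codePairDist_eq_idealB hN hirr h₃ hquad hI]
  refine ⟨rfl, Constacyclic.codePairDist_idealB_of_le rfl hN h₃ hquad, ?_⟩
  intro Γ γ hΓ hΓp hγ hlo hhi
  obtain ⟨k, rfl⟩ := Nat.exists_eq_add_of_le' hΓ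
  obtain ⟨r, rfl⟩ : ∃ r, s = r + 1 + γ := ⟨s - γ - 1, by omega⟩
  rw [show r + 1 + γ - γ = r + 1 by omega, Nat.add_sub_cancel] at hlo hhi
  rw [Nat.add_sub_cancel] at hlo
  have h1 : 1 ≤ p ^ γ := Nat.one_le_pow _ _ hp.pos
  -- With s = r + 1 + γ, this turns 2p^s - p^(s-γ) into p^s + p^(r+1)(p^γ - 1), so the bounds on I
  -- become those on j = I - p^s.
  have hsplit : p ^ (r + 1 + γ) = p ^ (r + 1) * (p ^ γ - 1) + p ^ (r + 1) := by
    zify [h1]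
    ring
  obtain ⟨j, rfl⟩ : ∃ j, I = p ^ (r + 1 + γ) + j := Nat.exists_eq_add_of_le (by omega)
  exact Constacyclic.codePairDist_idealB_of_lt rfl hα₀0 h₃ hquad (by omega) (by omega) (by omega)
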